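/- Conventions. A language $\mathscr L$ is a set of function symbols of finite positive arity (no constants), and $Fm_{\mathscr L}(\kappa)$ is the set of $\mathscr L$-formulas in variables $\{x_\alpha : \alpha<\kappa\}$, for $\kappa$ an infinite cardinal. A logic $\vdash$ is a substitution-invariant consequence relation on $Fm(\vdash)=Fm_{\mathscr L_\vdash}(\kappa_\vdash)$ for some language $\mathscr L_\vdash$ and infinite cardinal $\kappa_\vdash$. A matrix $\langle A,F\rangle$ is an algebra $A$ (with nonempty universe) together with a subset $F\subseteq A$; $F$ is a deductive filter of $\vdash$ on $A$, and $\langle A,F\rangle$ a model of $\vdash$, if $\Gamma\vdash\varphi$ and $h[\Gamma]\subseteq F$ imply $h(\varphi)\in F$, for all homomorphisms $h$ from the algebra of formulas of $\vdash$ to $A$. The Leibniz congruence $\Omega^A F$ is the largest congruence $\theta$ of $A$ such that $\langle a,b\rangle\in\theta$ and $a\in F$ imply $b\in F$. $\mathsf{Mod}^{\equiv}(\vdash)$ is the class of models $\langle A,F\rangle$ of $\vdash$ such that $\bigcap\{\Omega^A G : G\supseteq F \text{ a deductive filter of } \vdash \text{ on } A\}$ is the identity relation. A translation $\tau$ of $\mathscr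 L$ into $\mathscr L'$ assigns to each $n$-ary symbol of $\mathscr L$ an $\mathscr L'$-formula in variables $x_1,\dots,x_n$; given an $\mathscr L'$-algebra $A$, let $A^\tau$ be the $\mathscr L$-algebra on the same universe in which each symbol $*$ is interpreted by $\tau(*)^A$. An interpretation of $\vdash$ into $\vdash'$ is a translation $\tau$ of $\mathscr L_\vdash$ into $\mathscr L_{\vdash'}$ such that $\langle A^\tau,F\rangle\in\mathsf{Mod}^\equiv(\vdash)$ for all $\langle A,F\rangle\in\mathsf{Mod}^\equiv(\vdash')$; write ${\vdash}\le{\vdash'}$ if there is one. This is a preorder; $\mathsf{Log}$ is the induced poset of classes $[\![\vdash]\!]$ of equi-interpretable logics. For a family $(\vdash_i)_{i\in I}$ of logics indexed by a nonempty set $I$, the non-indexed product $\bigotimes_{i\in I}\vdash_i$ is the logic in the language whose $n$-ary symbols ($n\ge1$) are the sequences $\langle\varphi_i(x_1,\dots,x_n) : i\in I\rangle$ with $\varphi_i$ an $\mathscr L_{\vdash_i}$-formula, formulated in $\prod_{i\in I}|Fm(\vdash_i)|$ variables, and induced by the class of isomorphic copies of the matrices $\langle\prod_i A_i,\prod_i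 F_i\rangle$ with $\langle A_i,F_i\rangle\in\mathsf{Mod}^\equiv(\vdash_i)$, where $\langle\varphi_i : i\in I\rangle$ is interpreted as $(\vec a_1,\dots,\vec a_n)\mapsto\langle\varphi_i^{A_i}(\vec a_1(i),\dots,\vec a_n(i)) : i\in I\rangle$. (The logic in $\kappa$ variables induced by a class $\mathsf K$ of matrices is given by: $\Gamma\vdash\varphi$ iff, for all $\langle A,F\rangle\in\mathsf K$ and all homomorphisms $h$ from the algebra of formulas in $\kappa$ variables to $A$, $h[\Gamma]\subseteq F$ implies $h(\varphi)\in F$.) For $I=\emptyset$, the non-indexed product is the logic in the empty language, in countably many variables, induced by the one-element matrix $\langle\mathbf 1,\{1\}\rangle$. Theorem. For every family $(\vdash_i)_{i\in I}$ of logics indexed by a set $I$, the infimum of $\{[\![\vdash_i]\!] : i\in I\}$ in $\mathsf{Log}$ is $[\![\bigotimes_{i\in I}\vdash_i]\!]$. Hence $\mathsf{Log}$ is a set-complete meet-semilattice: every subset (as opposed to proper subclass) of $\mathsf{Log}$ has an infimum. -/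

import Mathlib

universe u

open Cardinal

namespace AAL

/-! ### Matrices

An algebraic language is a first-order language without relation symbols. Logics are formulated
in algebraic languages which, moreover, have no nullary function symbols. The set of formulas of
`L` with variables in `V` is `L.Term V`; homomorphisms from the formula algebra to an algebra `A`
are the maps `t ↦ t.realize v` for `v : V → A`, and substitutions are the maps
`t ↦ t.subst σ` for `σ : V → L.Term V`. -/

/-- A matrix: an algebra with nonempty universe together with a subset of its universe. -/
structure AlgMatrix (L : FirstOrder.Language.{u, 0}) where
  carrier : Type u
  [nonempty : Nonempty carrier]
  [str : L.Structure carrier]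
  filter : Set carrier

attribute [instance] AlgMatrix.nonempty AlgMatrix.str

/-- Isomorphism of matrices. -/
def AlgMatrix.Iso {L : FirstOrder.Language.{u, 0}} (M N : AlgMatrix L) : Prop :=
  ∃ e : FirstOrder.Language.Equiv L M.carrier N.carrier, ∀ a, e a ∈ N.filter ↔ a ∈ M.filter

/-! ### Leibniz congruences -/

/-- The equivalence relation `θ` is a congruence of the algebra `A`. -/
def IsCongruence (L : FirstOrder.Language.{u, 0}) {A : Type u} [L.Structure A] (θ : Setoid A) :
    Prop :=
  ∀ (n : ℕ) (f : L.Functions n) (a b : Fin n → A), (∀ k, θ (a k) (b k)) →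
    θ (FirstOrder.Language.Structure.funMap f a) (FirstOrder.Language.Structure.funMap f b)

/-- `θ` is compatible with `F`: it does not relate elements of `F` with elements outside `F`. -/
def Compatible {A : Type u} (θ : Setoid A) (F : Set A) : Prop :=
  ∀ a b, θ a b → a ∈ F → b ∈ F

/-- The Leibniz congruence of `F`: the largest congruence of `A` compatible with `F`. -/
def leibniz (L : FirstOrder.Language.{u, 0}) {A : Type u} [L.Structure A] (F : Set A) : Setoid A :=
  sSup {θ | IsCongruence L θ ∧ Compatible θ F}

/-- The supremum in the definition of `leibniz` is a maximum. -/
theorem leibniz_isGreatest (L : FirstOrder.Language.{u, 0}) {A : Type u} [L.Structure A]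
    (F : Set A) :
    IsGreatest {θ : Setoid A | IsCongruence L θ ∧ Compatible θ F} (leibniz L F) := by
  classical
  refine ⟨⟨?_, ?_⟩, fun θ hθ => le_sSup hθ⟩
  · intro n f a b hab
    have key : ∀ (k : Fin n) (c : Fin n → A) (x y : A), leibniz L F x y →
        leibniz L F (FirstOrder.Language.Structure.funMap f (Function.update c k x))
          (FirstOrder.Language.Structure.funMap f (Function.update c k y)) := by
      intro k c
      have : leibniz L F ≤ Setoid.comap
          (fun x => FirstOrder.Language.Structure.funMap f (Function.update c k x)) (leibniz L F) := by
        refine sSup_le fun θ hθ x y hxy => ?_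
        refine (le_sSup hθ : θ ≤ leibniz L F) (hθ.1 n f _ _ fun j => ?_)
        by_cases hj : j = k
        · subst hj; simpa using hxy
        · simp [Function.update_of_ne hj]
      exact fun x y hxy => this hxy
    have main : ∀ s : Finset (Fin n), leibniz L F (FirstOrder.Language.Structure.funMap f a)
        (FirstOrder.Language.Structure.funMap f (s.piecewise b a)) := by
      intro s
      induction s using Finset.induction_on with
      | empty => simp
      | insert k s hk ih =>
        refine (leibniz L F).trans ih ?_
        have h := key k (s.piecewise b a) (a k) (b k) (hab k)
        rw [Finset.piecewise_insert]
        rwa [show Function.update (s.piecewise b a) k (a k) = s.piecewise b a by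
          rw [← Finset.piecewise_eq_of_notMem s b a hk, Function.update_eq_self]] at h
    simpa using main Finset.univ
  · have : leibniz L F ≤ Setoid.ker (fun x => x ∈ F) := by
      refine sSup_le fun θ hθ x y hxy => ?_
      exact propext ⟨hθ.2 x y hxy, hθ.2 y x (θ.symm hxy)⟩
    intro a b hab ha
    have h : (a ∈ F) = (b ∈ F) := this hab
    exact h ▸ ha

/-! ### Logics and their models -/

/-- A logic: a substitution invariant consequence relation on the set of formulas of a language
without constants, in `κ` variables for an infinite cardinal `κ`. The variables are indexed by
the ordinals smaller than `κ`. -/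
structure Logic where
  lang : FirstOrder.Language.{u, 0}
  [algebraic : lang.IsAlgebraic]
  [noConstants : IsEmpty (lang.Functions 0)]
  κ : Cardinal.{u}
  aleph0_le : ℵ₀ ≤ κ
  entails : Set (lang.Term κ.ord.ToType) → lang.Term κ.ord.ToType → Prop
  refl : ∀ Γ φ, φ ∈ Γ → entails Γ φ
  cut : ∀ Γ Δ φ, (∀ ψ ∈ Δ, entails Γ ψ) → entails Δ φ → entails Γ φ
  structural : ∀ (σ : κ.ord.ToType → lang.Term κ.ord.ToType) Γ φ, entails Γ φ →
    entails ((fun ψ => ψ.subst σ) '' Γ) (φ.subst σ)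

attribute [instance] Logic.algebraic Logic.noConstants

namespace Logic

/-- The variables of a logic. -/
abbrev Var (S : Logic.{u}) : Type u := S.κ.ord.ToType

/-- The formulas of a logic. -/
abbrev Fm (S : Logic.{u}) : Type u := S.lang.Term S.Var

/-- `F` is a deductive filter of the logic on the algebra `A`. -/
def IsFilter (S : Logic.{u}) {A : Type u} [S.lang.Structure A] (F : Set A) : Prop :=
  ∀ (Γ : Set S.Fm) (φ : S.Fm), S.entails Γ φ →
    ∀ v : S.Var → A, (∀ γ ∈ Γ, γ.realize v ∈ F) → φ.realize v ∈ F

/-- The Suszko congruence of `F`: the intersection of the Leibniz congruences of the deductive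
filters extending `F`. -/
def suszko (S : Logic.{u}) {A : Type u} [S.lang.Structure A] (F : Set A) : Setoid A :=
  sInf {θ | ∃ G : Set A, S.IsFilter G ∧ F ⊆ G ∧ θ = leibniz S.lang G}

/-- The class of models of a logic. -/
def Mod (S : Logic.{u}) : Set (AlgMatrix S.lang) :=
  {M | S.IsFilter M.filter}

/-- The class of models of a logic whose Suszko congruence is the identity relation. -/
def ModSuszko (S : Logic.{u}) : Set (AlgMatrix S.lang) :=
  {M | M ∈ S.Mod ∧ S.suszko M.filter = ⊥}

/-- The logic in `κ` variables induced by a class of matrices `K`. -/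
def induced {L : FirstOrder.Language.{u, 0}} [L.IsAlgebraic] [IsEmpty (L.Functions 0)]
    (κ : Cardinal.{u}) (hκ : ℵ₀ ≤ κ) (K : Set (AlgMatrix L)) : Logic.{u} where
  lang := L
  κ := κ
  aleph0_le := hκ
  entails Γ φ := ∀ M ∈ K, ∀ v : κ.ord.ToType → M.carrier,
    (∀ γ ∈ Γ, γ.realize v ∈ M.filter) → φ.realize v ∈ M.filter
  refl _ φ hφ _ _ _ h := h φ hφ
  cut _ _ _ h₁ h₂ M hM v h := h₂ M hM v fun ψ hψ => h₁ ψ hψ M hM v h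
  structural σ Γ φ h M hM v hv := by
    rw [FirstOrder.Language.Term.realize_subst]
    refine h M hM _ fun γ hγ => ?_
    rw [← FirstOrder.Language.Term.realize_subst]
    exact hv _ ⟨γ, hγ, rfl⟩

end Logic

/-! ### Interpretations -/

/-- A translation associates with every `n`-ary function symbol of `L` a formula of `L'` in
the variables `x₁, …, xₙ`. -/
abbrev Translation (L L' : FirstOrder.Language.{u, 0}) : Type u :=
  ∀ n : ℕ, L.Functions n → L'.Term (Fin n)

/-- Given an `L'`-algebra `A` and a translation `τ` of `L` into `L'`, this is the `L`-algebra
`A^τ`. -/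
abbrev Translation.structure {L L' : FirstOrder.Language.{u, 0}} [L.IsAlgebraic]
    (τ : Translation L L') (A : Type u) [L'.Structure A] : L.Structure A where
  funMap {n} f a := (τ n f).realize a

/-- The matrix `⟨A^τ, F⟩` obtained from the matrix `⟨A, F⟩`. -/
def AlgMatrix.reduct {L L' : FirstOrder.Language.{u, 0}} [L.IsAlgebraic] (τ : Translation L L')
    (M : AlgMatrix L') : AlgMatrix L where
  carrier := M.carrier
  str := τ.structure M.carrier
  filter := M.filter

/-- The translation `τ` is an interpretation of `S` into `S'`. -/
def IsInterpretation (S S' : Logic.{u}) (τ : Translation S.lang S'.lang) : Prop :=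
  ∀ M ∈ S'.ModSuszko, M.reduct τ ∈ S.ModSuszko

/-- The logic `S` is interpretable into the logic `S'`. -/
def Interpretable (S S' : Logic.{u}) : Prop :=
  ∃ τ : Translation S.lang S'.lang, IsInterpretation S S' τ

/-- The identity translation. -/
def Translation.id (L : FirstOrder.Language.{u, 0}) : Translation L L :=
  fun _ f => FirstOrder.Language.Term.func f FirstOrder.Language.Term.var

/-- The extension of a translation to formulas. -/
def Translation.onTerm {L L' : FirstOrder.Language.{u, 0}} (τ : Translation L L') {V : Type} :
    L.Term V → L'.Term V
  | .var a => .var a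
  | .func f ts => (τ _ f).subst fun k => τ.onTerm (ts k)

theorem Translation.realize_onTerm {L L' : FirstOrder.Language.{u, 0}} [L.IsAlgebraic]
    (τ : Translation L L') (A : Type u) [L'.Structure A] {V : Type} (t : L.Term V) (v : V → A) :
    (τ.onTerm t).realize v = @FirstOrder.Language.Term.realize L A (τ.structure A) V v t := by
  induction t with
  | var a => rfl
  | func f ts ih =>
    rw [Translation.onTerm, FirstOrder.Language.Term.realize_subst]
    simp only [ih]
    rfl

theorem AlgMatrix.reduct_id {L : FirstOrder.Language.{u, 0}} [L.IsAlgebraic] (M : AlgMatrix L) :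
    M.reduct (Translation.id L) = M := by
  obtain ⟨A, F⟩ := M
  have : (Translation.id L).structure A = ‹L.Structure A› := by
    ext n f
    · rfl
    · exact isEmptyElim f
  unfold AlgMatrix.reduct
  congr

theorem AlgMatrix.reduct_reduct {L L' L'' : FirstOrder.Language.{u, 0}} [L.IsAlgebraic]
    [L'.IsAlgebraic] (τ : Translation L L') (ρ : Translation L' L'') (M : AlgMatrix L'') :
    M.reduct (fun n f => ρ.onTerm (τ n f)) = (M.reduct ρ).reduct τ := by
  have : Translation.structure (fun n f => ρ.onTerm (τ n f)) M.carrier =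
      @Translation.structure L L' _ τ M.carrier (ρ.structure M.carrier) := by
    ext n f a
    · exact ρ.realize_onTerm M.carrier (τ n f) a
    · exact isEmptyElim f
  unfold AlgMatrix.reduct
  congr

/-- Logics are preordered by interpretability. -/
instance : Preorder Logic.{u} where
  le := Interpretable
  le_refl S := ⟨Translation.id S.lang, fun M hM => by rwa [AlgMatrix.reduct_id]⟩
  le_trans _ _ _ := fun ⟨τ, hτ⟩ ⟨ρ, hρ⟩ =>
    ⟨fun n f => ρ.onTerm (τ n f), fun M hM => by
      rw [AlgMatrix.reduct_reduct]
      exact hτ _ (hρ _ hM)⟩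

/-- The poset of all logics: classes of equi-interpretable logics ordered under
interpretability. -/
abbrev Log : Type (u + 1) := Antisymmetrization Logic.{u} (· ≤ ·)

/-- The class of all logics equi-interpretable with a given one. -/
abbrev Logic.toLog (S : Logic.{u}) : Log.{u} := toAntisymmetrization (· ≤ ·) S

/-! ### Non-indexed products -/

section NonIndexedProduct

variable {I : Type u}

/-- The non-indexed product of a family of languages: its `n`-ary symbols are the families of
formulas `φᵢ` of `Lᵢ` in the variables `x₁, …, xₙ`. -/
def prodLang (L : I → FirstOrder.Language.{u, 0}) : FirstOrder.Language.{u, 0} where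
  Functions n := ∀ i, (L i).Term (Fin n)
  Relations _ := Empty

instance (L : I → FirstOrder.Language.{u, 0}) : (prodLang L).IsAlgebraic :=
  fun _ => inferInstanceAs (IsEmpty Empty)

theorem isEmpty_closedTerm (L : FirstOrder.Language.{u, 0}) [IsEmpty (L.Functions 0)] :
    IsEmpty (L.Term (Fin 0)) := by
  refine ⟨fun t => ?_⟩
  induction t with
  | var a => exact isEmptyElim a
  | @func l f ts ih =>
    cases l with
    | zero => exact isEmptyElim f
    | succ l => exact ih 0

instance [Nonempty I] (L : I → FirstOrder.Language.{u, 0}) [∀ i, IsEmpty ((L i).Functions 0)] :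
    IsEmpty ((prodLang L).Functions 0) :=
  ⟨fun f => (isEmpty_closedTerm (L (Classical.arbitrary I))).false (f (Classical.arbitrary I))⟩

/-- The non-indexed product of a family of matrices. -/
def prodMatrix {L : I → FirstOrder.Language.{u, 0}} (M : ∀ i, AlgMatrix (L i)) :
    AlgMatrix (prodLang L) where
  carrier := ∀ i, (M i).carrier
  str :=
    { funMap := fun {_} f a i => FirstOrder.Language.Term.realize (fun k => a k i) (f i)
      RelMap := fun {_} r => Empty.elim r }
  filter := {a | ∀ i, a i ∈ (M i).filter}

/-- The non-indexed product of a family of classes of matrices, closed under isomorphism. -/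
def prodClass {L : I → FirstOrder.Language.{u, 0}} (K : ∀ i, Set (AlgMatrix (L i))) :
    Set (AlgMatrix (prodLang L)) :=
  {N | ∃ M : ∀ i, AlgMatrix (L i), (∀ i, M i ∈ K i) ∧ N.Iso (prodMatrix M)}

theorem aleph0_le_prod [Nonempty I] (S : I → Logic.{u}) :
    ℵ₀ ≤ Cardinal.prod fun i => #(S i).Fm := by
  have hv : ∀ i, ℵ₀ ≤ #(S i).Fm := fun i => by
    have h : #(S i).Var ≤ #(S i).Fm :=
      Cardinal.mk_le_of_injective (f := fun a => (FirstOrder.Language.Term.var a : (S i).Fm))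
        fun a b hab => by injection hab
    rw [Cardinal.mk_ord_toType] at h
    exact (S i).aleph0_le.trans h
  classical
  have hne : ∀ i, Nonempty (S i).Fm := fun i =>
    Cardinal.mk_ne_zero_iff.1 (Cardinal.aleph0_pos.trans_le (hv i)).ne'
  let j := Classical.arbitrary I
  refine (hv j).trans ?_
  rw [← Cardinal.mk_pi]
  exact Cardinal.mk_le_of_injective
    (Function.update_injective (fun i => Classical.choice (hne i)) j)

/-- The empty language. -/
def emptyLang : FirstOrder.Language.{u, 0} where
  Functions _ := PEmpty
  Relations _ := Empty

instance : emptyLang.{u}.IsAlgebraic := fun _ => inferInstanceAs (IsEmpty Empty)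

instance : IsEmpty (emptyLang.{u}.Functions 0) := inferInstanceAs (IsEmpty PEmpty)

/-- The trivial matrix `⟨1, {1}⟩` in the empty language. -/
def trivialMatrix : AlgMatrix emptyLang.{u} where
  carrier := PUnit
  str :=
    { funMap := fun {_} f => PEmpty.elim f
      RelMap := fun {_} r => Empty.elim r }
  filter := Set.univ

open Classical in
/-- The non-indexed product of a family of logics: the logic in the non-indexed product of the
languages, in `∏ᵢ |Fm(Sᵢ)|` variables, that is induced by the non-indexed product of the classes
`ModSuszko (Sᵢ)`. For the empty family it is, by convention, the logic in the empty language, in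
countably many variables, that is induced by the trivial matrix. -/
noncomputable def Logic.prod (S : I → Logic.{u}) : Logic.{u} :=
  if _h : Nonempty I then
    Logic.induced (Cardinal.prod fun i => #(S i).Fm) (aleph0_le_prod S)
      (prodClass fun i => (S i).ModSuszko)
  else
    Logic.induced ℵ₀ le_rfl {trivialMatrix}

end NonIndexedProduct

end AAL

/-!
The crux is that a product of reduced models of logics `Sᵢ` can be recognized inside an arbitrary
reduced model `A` of the non-indexed product, although `A` need not itself be a product.

*Lower bound.* Sending each symbol to its component at `i` interprets the product into `Sᵢ`
(`prodLogic_le`). Since trivial matrices belong to `ModSuszko` of every logic, a member of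
`ModSuszko (Sᵢ)` is, up to isomorphism, a product with trivial other factors; hence the product has
exactly those consequences that hold componentwise (`conseq_prod_iff`). Passing to Suszko quotients
(`exists_reduction`), every deductive filter of `Sᵢ` is one of the product (`isFilter_viaProj`), and
no congruences are gained, because every operation of `Sᵢ` is the component of some symbol.

*Greatest lower bound.* Let `T` be interpretable into all `Sᵢ` by translations `τᵢ`; then
`f ↦ ⟨τᵢ(f) : i ∈ I⟩` interprets `T` into the product (`le_prodLogic`). Let `A` be a member of
`ModSuszko` of the product and `G` a deductive filter with `c ∈ G`. The product language has the
binary operations `dᵢ(x, z)`, equal to `x` at `i` and to `z` elsewhere, and `A` satisfies the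
identities of the product class (`realize_eq_of_mem_modSuszko`). Therefore the range of
`x ↦ dᵢ(x, c)` is an algebra of the language of `Sᵢ`, onto which `A` maps homomorphically
(`toComponent_funMap`) and on which `G` restricts to a deductive filter of `Sᵢ`
(`isFilter_component`); moreover `a ∈ G` iff `dᵢ(a, c) ∈ G` for all `i`
(`mem_filter_iff_replaceOff_mem`). The Suszko quotient of this component lies in `ModSuszko (Sᵢ)`,
so its reduct along `τᵢ` lies in `ModSuszko (T)`. Filters of `T` pulled back from these quotients
separate the points of `A` (`not_suszko_of_mem_of_notMem`). A base point `c` exists whenever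
needed: a filter that separates two points, or contains the values of some premises of a rule, is
nonempty, and the translation of a theorem of `T` to one variable is a theorem of the product (`filter_nonempty_of_theorem`).

For the empty family, the reduced models of the product are one-element algebras, so every logic is
interpretable into it (`le_induced_trivialMatrix`).
-/

namespace AAL

open FirstOrder FirstOrder.Language

/-! ### Leibniz congruences and polynomials -/

theorem IsCongruence.realize {L : FirstOrder.Language.{u, 0}} {A : Type u} [L.Structure A]
    {θ : Setoid A} (hθ : IsCongruence L θ) {V : Type*} (t : L.Term V) {v w : V → A}
    (h : ∀ x, θ (v x) (w x)) :
    θ (t.realize v) (t.realize w) := by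
  induction t with
  | var x => exact h x
  | func f ts ih => exact hθ _ f _ _ ih

/-- For an equivalence relation to be a congruence, it suffices that it is preserved when the
arguments of an operation are changed one at a time. -/
theorem isCongruence_of_update {L : FirstOrder.Language.{u, 0}} {A : Type u} [L.Structure A]
    {θ : Setoid A}
    (h : ∀ (n : ℕ) (f : L.Functions n) (k : Fin n) (c : Fin n → A) (x y : A), θ x y →
      θ (Structure.funMap f (Function.update c k x)) (Structure.funMap f (Function.update c k y))) :
    IsCongruence L θ := by
  classical
  intro n f a b hab
  have main : ∀ s : Finset (Fin n),
      θ (Structure.funMap f a) (Structure.funMap f (s.piecewise b a)) := by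
    intro s
    induction s using Finset.induction_on with
    | empty => simp
    | insert k s hk ih =>
      refine θ.trans ih ?_
      have hk' : Function.update (s.piecewise b a) k (a k) = s.piecewise b a := by
        rw [← Finset.piecewise_eq_of_notMem s b a hk, Function.update_eq_self]
      have := h n f k (s.piecewise b a) (a k) (b k) (hab k)
      rw [hk'] at this
      rwa [Finset.piecewise_insert]
  simpa using main Finset.univ

/-- Two elements are related by the Leibniz congruence of `F` iff no unary polynomial function
separates them with respect to `F`. The distinguished variable of a polynomial is `none`, and `v`
assigns values to its parameters. -/
theorem leibniz_iff {L : FirstOrder.Language.{u, 0}} {A : Type u} [L.Structure A]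
    {F : Set A} {a b : A} : leibniz L F a b ↔
      ∀ (V : Type) [Countable V] (p : L.Term (Option V)) (v : V → A),
      p.realize (fun o => o.elim a v) ∈ F ↔ p.realize (fun o => o.elim b v) ∈ F := by
  classical
  constructor
  · intro h V _ p v
    obtain ⟨hc, hF⟩ := (leibniz_isGreatest L F).1
    have key : leibniz L F (p.realize fun o => o.elim a v) (p.realize fun o => o.elim b v) :=
      hc.realize p fun o => by
        cases o with
        | none => exact h
        | some x => exact (leibniz L F).refl _
    exact ⟨hF _ _ key, hF _ _ ((leibniz L F).symm key)⟩
  · intro h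
    let θ : Setoid A :=
      { r := fun a b => ∀ (V : Type) [Countable V] (p : L.Term (Option V)) (v : V → A),
          p.realize (fun o => o.elim a v) ∈ F ↔ p.realize (fun o => o.elim b v) ∈ F
        iseqv :=
          { refl := fun _ _ _ _ _ => Iff.rfl
            symm := fun h V _ p v => (h V p v).symm
            trans := by
              intro x y z h₁ h₂ V _ p v
              rw [h₁ V p v, h₂ V p v] } }
    refine (leibniz_isGreatest L F).2 (show θ ∈ _ from ⟨isCongruence_of_update ?_, ?_⟩) h
    · intro n f k c x y hxy V _ p v
      have key : ∀ z, p.realize (fun o => o.elim (Structure.funMap f (Function.update c k z)) v) =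
          (p.subst fun o => o.elim
            (Term.func f fun j => if j = k then .var none else .var (some (.inr j)))
            fun x => (.var (some (.inl x)) : L.Term (Option (V ⊕ Fin n)))).realize
          (fun o => o.elim z (Sum.elim v c)) := by
        intro z
        rw [Term.realize_subst]
        congr 1
        funext o
        cases o with
        | none =>
          simp only [Option.elim, Term.realize_func]
          congr 1
          funext j
          by_cases hj : j = k
          · subst hj; simp
          · simp [hj]
        | some x => rfl
      rw [key, key]
      exact hxy _ _ _
    · intro a b hab ha
      simpa using (hab Empty (.var none) Empty.elim).1 ha

theorem suszko_iff {S : Logic.{u}} {A : Type u} [S.lang.Structure A] {F : Set A} {a b : A} :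
    S.suszko F a b ↔ ∀ G, S.IsFilter G → F ⊆ G → leibniz S.lang G a b := by
  unfold Logic.suszko
  change (∀ r ∈ {θ | ∃ G, S.IsFilter G ∧ F ⊆ G ∧ θ = leibniz S.lang G}, r a b) ↔ _
  constructor
  · exact fun h G hG hFG => h _ ⟨G, hG, hFG, rfl⟩
  · rintro h _ ⟨G, hG, hFG, rfl⟩
    exact h G hG hFG

theorem isCongruence_suszko {S : Logic.{u}} {A : Type u} [S.lang.Structure A] (F : Set A) :
    IsCongruence S.lang (S.suszko F) := fun n f a b hab =>
  suszko_iff.2 fun G hG hFG =>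
    (leibniz_isGreatest S.lang G).1.1 n f a b fun k => suszko_iff.1 (hab k) G hG hFG

/-! ### Homomorphisms -/

/-- A map commuting with the operations is a homomorphism, as there are no relation symbols. -/
def homOfAlgebraic {L : FirstOrder.Language.{u, 0}} [L.IsAlgebraic] {A B : Type u} [L.Structure A]
    [L.Structure B] (h : A → B)
    (hh : ∀ (n : ℕ) (f : L.Functions n) (x : Fin n → A),
      h (Structure.funMap f x) = Structure.funMap f (h ∘ x)) : A →[L] B where
  toFun := h
  map_fun' f x := hh _ f x
  map_rel' r := isEmptyElim r

theorem Logic.IsFilter.preimage {S : Logic.{u}} {A B : Type u} [S.lang.Structure A]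
    [S.lang.Structure B] {G : Set B} (hG : S.IsFilter G) (h : A →[S.lang] B) :
    S.IsFilter (h ⁻¹' G) := by
  intro Γ φ hφ v hv
  rw [Set.mem_preimage, ← HomClass.realize_term]
  refine hG Γ φ hφ _ fun γ hγ => ?_
  rw [HomClass.realize_term]
  exact hv γ hγ

theorem Logic.IsFilter.of_preimage {S : Logic.{u}} {A B : Type u} [S.lang.Structure A]
    [S.lang.Structure B] {G : Set B} (h : A →[S.lang] B) (hs : Function.Surjective h)
    (hG : S.IsFilter (h ⁻¹' G)) : S.IsFilter G := by
  intro Γ φ hφ v hv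
  obtain ⟨w, rfl⟩ := hs.comp_left v
  rw [HomClass.realize_term]
  refine hG Γ φ hφ _ fun γ hγ => ?_
  rw [Set.mem_preimage, ← HomClass.realize_term]
  exact hv γ hγ

theorem leibniz_preimage_iff {L : FirstOrder.Language.{u, 0}} {A B : Type u} [L.Structure A]
    [L.Structure B] {G : Set B} (h : A →[L] B) (hs : Function.Surjective h) {a b : A} :
    leibniz L (h ⁻¹' G) a b ↔ leibniz L G (h a) (h b) := by
  have key : ∀ (V : Type) (p : L.Term (Option V)) (v : V → A) (c : A),
      p.realize (fun o => o.elim c v) ∈ h ⁻¹' G ↔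
        p.realize (fun o => o.elim (h c) (h ∘ v)) ∈ G := by
    intro V p v c
    rw [Set.mem_preimage, ← HomClass.realize_term]
    refine iff_of_eq (congrArg (fun w => p.realize w ∈ G) ?_)
    funext o
    cases o <;> rfl
  rw [leibniz_iff, leibniz_iff]
  constructor
  · intro H V _ p v
    obtain ⟨w, rfl⟩ := hs.comp_left v
    exact (key V p w a).symm.trans ((H V p w).trans (key V p w b))
  · intro H V _ p v
    exact (key V p v a).trans ((H V p _).trans (key V p v b).symm)

/-- The quotient of the matrix `⟨A, F⟩` by its Suszko congruence. The operations are computed on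
representatives chosen by `Quotient.out`. -/
noncomputable def Logic.suszkoQuotient (S : Logic.{u}) {A : Type u} [Nonempty A]
    [S.lang.Structure A] (F : Set A) : AlgMatrix S.lang where
  carrier := Quotient (S.suszko F)
  nonempty := ‹Nonempty A›.map (Quotient.mk _)
  str := { funMap := fun f x => Quotient.mk _ (Structure.funMap f fun k => (x k).out) }
  filter := Quotient.mk _ '' F

/-- Every model maps onto a member of `ModSuszko` by a surjective strict homomorphism, namely onto
its quotient by its Suszko congruence. -/
theorem exists_reduction (S : Logic.{u}) {A : Type u} [Nonempty A] [S.lang.Structure A]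
    {F : Set A} (hF : S.IsFilter F) :
    ∃ Q ∈ S.ModSuszko, ∃ q : A →[S.lang] Q.carrier, Function.Surjective q ∧
      ∀ a, q a ∈ Q.filter ↔ a ∈ F := by
  let θ := S.suszko F
  let q : A →[S.lang] (S.suszkoQuotient F).carrier := homOfAlgebraic (Quotient.mk θ) fun n f x =>
    Quotient.sound (isCongruence_suszko F n f _ _ fun k => θ.symm (Quotient.mk_out (x k)))
  have hq : Function.Surjective q := Quotient.mk_surjective
  have hθ : ∀ {a b}, q a = q b → S.suszko F a b := fun h => Quotient.exact h
  -- Filters above `F` are saturated for the Suszko congruence of `F`, hence are preimages.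
  have hsat : ∀ G, S.IsFilter G → F ⊆ G → q ⁻¹' (q '' G) = G := by
    intro G hG hFG
    refine Set.Subset.antisymm ?_ (Set.subset_preimage_image q G)
    rintro a ⟨b, hb, hba⟩
    exact (leibniz_isGreatest S.lang G).1.2 _ _ (suszko_iff.1 (hθ hba) G hG hFG) hb
  have hfil : ∀ G, S.IsFilter G → F ⊆ G → S.IsFilter (q '' G) := fun G hG hFG =>
    Logic.IsFilter.of_preimage q hq (by rwa [hsat G hG hFG])
  refine ⟨S.suszkoQuotient F, ⟨hfil F hF subset_rfl, ?_⟩, q, hq, fun a => ?_⟩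
  · rw [eq_bot_iff]
    intro x y hxy
    obtain ⟨a, rfl⟩ := hq x
    obtain ⟨b, rfl⟩ := hq y
    refine Quotient.sound (suszko_iff.2 fun G hG hFG => ?_)
    have := suszko_iff.1 hxy (q '' G) (hfil G hG hFG) (Set.image_mono hFG)
    rwa [← leibniz_preimage_iff q hq, hsat G hG hFG] at this
  · exact Set.ext_iff.1 (hsat F hF subset_rfl) a

/-! ### Trivial matrices -/

theorem mem_modSuszko_of_subsingleton (S : Logic.{u}) (M : AlgMatrix S.lang)
    [Subsingleton M.carrier] (hM : M.filter = Set.univ) : M ∈ S.ModSuszko := by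
  refine ⟨fun _ _ _ _ _ => hM ▸ Set.mem_univ _, ?_⟩
  rw [eq_bot_iff]
  exact fun a b _ => Subsingleton.elim a b

theorem exists_trivial_mem_modSuszko (S : Logic.{u}) :
    ∃ M ∈ S.ModSuszko, M.filter = Set.univ := by
  let M : AlgMatrix S.lang :=
    { carrier := PUnit, str := { funMap := fun _ _ => PUnit.unit }, filter := Set.univ }
  have : Subsingleton M.carrier := inferInstanceAs (Subsingleton PUnit)
  exact ⟨M, mem_modSuszko_of_subsingleton S M rfl, rfl⟩

/-! ### Logics induced by classes of matrices -/

theorem isFilter_induced_iff {L : FirstOrder.Language.{u, 0}} [L.IsAlgebraic]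
    [IsEmpty (L.Functions 0)] {κ : Cardinal.{u}} {hκ : ℵ₀ ≤ κ} {K : Set (AlgMatrix L)} {A : Type u}
    [L.Structure A] {G : Set A} :
    @Logic.IsFilter (Logic.induced κ hκ K) A ‹_› G ↔
      ∀ (Γ : Set (L.Term κ.ord.ToType)) (φ : L.Term κ.ord.ToType),
        (∀ M ∈ K, ∀ v : κ.ord.ToType → M.carrier,
          (∀ γ ∈ Γ, γ.realize v ∈ M.filter) → φ.realize v ∈ M.filter) →
        ∀ v : κ.ord.ToType → A, (∀ γ ∈ Γ, γ.realize v ∈ G) → φ.realize v ∈ G :=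
  Iff.rfl

theorem suszko_induced_iff {L : FirstOrder.Language.{u, 0}} [L.IsAlgebraic]
    [IsEmpty (L.Functions 0)] {κ : Cardinal.{u}} {hκ : ℵ₀ ≤ κ} {K : Set (AlgMatrix L)} {A : Type u}
    [L.Structure A] {F : Set A} {a b : A} :
    @Logic.suszko (Logic.induced κ hκ K) A ‹_› F a b ↔
      ∀ G, @Logic.IsFilter (Logic.induced κ hκ K) A ‹_› G → F ⊆ G → leibniz L G a b :=
  @suszko_iff (Logic.induced κ hκ K) A ‹_› F a b

/-- A deductive filter of the logic induced by `K` in `κ` variables is closed under all semantic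
consequences of `K` whose variables can be embedded into `κ`. -/
theorem mem_filter_of_conseq {L : FirstOrder.Language.{u, 0}} [L.IsAlgebraic]
    [IsEmpty (L.Functions 0)] {κ : Cardinal.{u}} {hκ : ℵ₀ ≤ κ} {K : Set (AlgMatrix L)} {A : Type u}
    [L.Structure A] {G : Set A} (hG : @Logic.IsFilter (Logic.induced κ hκ K) A ‹_› G) {V : Type*}
    (g : V ↪ κ.ord.ToType) {Γ : Set (L.Term V)} {φ : L.Term V}
    (h : ∀ M ∈ K, ∀ v : V → M.carrier,
      (∀ γ ∈ Γ, γ.realize v ∈ M.filter) → φ.realize v ∈ M.filter)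
    {v : V → A} (hv : ∀ γ ∈ Γ, γ.realize v ∈ G) : φ.realize v ∈ G := by
  obtain ⟨x⟩ : Nonempty A := ⟨φ.realize v⟩
  have key := isFilter_induced_iff.1 hG (Term.relabel g '' Γ) (φ.relabel g) ?_
    (Function.extend g v fun _ => x) ?_
  · rwa [Term.realize_relabel, Function.extend_comp g.injective] at key
  · intro M hM w hw
    rw [Term.realize_relabel]
    refine h M hM _ fun γ hγ => ?_
    rw [← Term.realize_relabel]
    exact hw _ ⟨γ, hγ, rfl⟩
  · rintro _ ⟨γ, hγ, rfl⟩
    rw [Term.realize_relabel, Function.extend_comp g.injective]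
    exact hv γ hγ

theorem nonempty_embedding_of_countable {κ : Cardinal.{u}} (hκ : ℵ₀ ≤ κ) (V : Type)
    [Countable V] : Nonempty (V ↪ κ.ord.ToType) := by
  rw [← Cardinal.lift_mk_le', Cardinal.mk_ord_toType]
  exact (Cardinal.lift_le_aleph0.2 (Cardinal.mk_le_aleph0)).trans
    (Cardinal.aleph0_le_lift.2 hκ)

/-- The identities that hold in `K` hold in all members of `ModSuszko` of the logic induced
by `K`. -/
theorem realize_eq_of_mem_modSuszko {L : FirstOrder.Language.{u, 0}} [L.IsAlgebraic]
    [IsEmpty (L.Functions 0)] {κ : Cardinal.{u}} {hκ : ℵ₀ ≤ κ} {K : Set (AlgMatrix L)}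
    {M : AlgMatrix L} (hM : M ∈ (Logic.induced κ hκ K).ModSuszko) {V : Type} [Countable V]
    {φ ψ : L.Term V}
    (h : ∀ N ∈ K, ∀ v : V → N.carrier, φ.realize v = ψ.realize v) (v : V → M.carrier) :
    φ.realize v = ψ.realize v := by
  suffices H : @Logic.suszko (Logic.induced κ hκ K) M.carrier M.str M.filter
      (φ.realize v) (ψ.realize v) by
    rw [hM.2] at H
    exact H
  refine suszko_induced_iff.2 fun G hG _ => leibniz_iff.2 fun W _ p w => ?_
  -- `p(φ)` and `p(ψ)` as formulas in the disjoint union of the two sets of variables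
  let s : L.Term V → L.Term (V ⊕ W) := fun χ =>
    p.subst fun o => o.elim (χ.relabel Sum.inl) fun x => .var (.inr x)
  have hs : ∀ (N : Type u) [L.Structure N] (u : V ⊕ W → N) (χ : L.Term V), (s χ).realize u =
      p.realize fun o => o.elim (χ.realize (u ∘ Sum.inl)) (u ∘ Sum.inr) := by
    intro N _ u χ
    rw [Term.realize_subst]
    congr 1
    funext o
    cases o with
    | none => exact Term.realize_relabel
    | some x => rfl
  obtain ⟨g⟩ := nonempty_embedding_of_countable hκ (V ⊕ W)
  have key : ∀ χ χ' : L.Term V,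
      (∀ N ∈ K, ∀ v : V → N.carrier, χ.realize v = χ'.realize v) →
      p.realize (fun o => o.elim (χ.realize v) w) ∈ G →
        p.realize (fun o => o.elim (χ'.realize v) w) ∈ G := by
    intro χ χ' hχ hp
    have := mem_filter_of_conseq hG g (Γ := {s χ}) (φ := s χ') ?_ (v := Sum.elim v w) ?_
    · rw [hs] at this
      exact this
    · intro N hN u hu
      have := hu _ rfl
      rw [hs] at this ⊢
      rwa [← hχ N hN]
    · rintro _ rfl
      rw [hs]
      exact hp
  exact ⟨key φ ψ h, key ψ φ fun N hN v => (h N hN v).symm⟩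

/-! ### Non-indexed products of languages and matrices -/

section

variable {I : Type u} {L : I → FirstOrder.Language.{u, 0}}

/-- The translation of the non-indexed product of the languages `Lᵢ` into `Lᵢ` that sends a family
of formulas to its component at `i`. -/
def projTranslation (L : I → FirstOrder.Language.{u, 0}) (i : I) :
    Translation (prodLang L) (L i) :=
  fun _ f => f i

/-- A matrix of the language `Lᵢ`, as a matrix of the product language in which the symbols act
through their components at `i`. -/
abbrev viaProj (L : I → FirstOrder.Language.{u, 0}) [∀ i, (L i).IsAlgebraic] (i : I)
    (M : AlgMatrix (L i)) : AlgMatrix (prodLang L) :=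
  M.reduct (projTranslation L i)

/-- The projection of a non-indexed product of matrices onto a factor, as a homomorphism of
algebras in the product language. -/
def projHom [∀ i, (L i).IsAlgebraic] (M : ∀ i, AlgMatrix (L i)) (i : I) :
    (prodMatrix M).carrier →[prodLang L] (viaProj L i (M i)).carrier :=
  homOfAlgebraic (A := (prodMatrix M).carrier)
    (B := (viaProj L i (M i)).carrier) (fun a => a i) fun _ _ _ => rfl

theorem realize_prodMatrix [∀ i, (L i).IsAlgebraic] (M : ∀ i, AlgMatrix (L i)) {V : Type*}
    (t : (prodLang L).Term V) (v : V → (prodMatrix M).carrier) (i : I) :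
    t.realize v i = t.realize (M := (viaProj L i (M i)).carrier)
      (fun x => v x i) :=
  (HomClass.realize_term (projHom M i)).symm

open Classical in
/-- The symbol of the product language whose component at `i` is the formula `t` in the variables
`x₁, …, xₙ` and whose other components are the variable `xₙ₊₁`. -/
noncomputable def padSymbol (i : I) {n : ℕ} (t : (L i).Term (Fin n)) :
    (prodLang L).Functions (n + 1) :=
  Function.update (β := fun j => (L j).Term (Fin (n + 1))) (fun _ => .var (Fin.last n)) i
    (t.relabel Fin.castSucc)

theorem funMap_padSymbol_self [∀ i, (L i).IsAlgebraic] (i : I) {n : ℕ} (t : (L i).Term (Fin n))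
    (M : AlgMatrix (L i)) (x : Fin n → M.carrier) (z : M.carrier) :
    Structure.funMap (M := (viaProj L i M).carrier) (padSymbol i t)
      (Fin.snoc (α := fun _ => M.carrier) x z) = t.realize x := by
  change Term.realize (L := L i) (Fin.snoc (α := fun _ => M.carrier) x z) (padSymbol i t i) = _
  classical
  rw [padSymbol, Function.update_self, Term.realize_relabel]
  congr 1
  funext k
  simp

theorem funMap_padSymbol_of_ne [∀ i, (L i).IsAlgebraic] {i j : I} (h : j ≠ i) {n : ℕ}
    (t : (L i).Term (Fin n))
    (M : AlgMatrix (L j)) (x : Fin n → M.carrier) (z : M.carrier) :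
    Structure.funMap (M := (viaProj L j M).carrier) (padSymbol i t)
      (Fin.snoc (α := fun _ => M.carrier) x z) = z := by
  change Term.realize (L := L j) (Fin.snoc (α := fun _ => M.carrier) x z) (padSymbol i t j) = _
  classical
  rw [padSymbol, Function.update_of_ne h]
  simp

/-- The formula of the product language obtained by applying the symbol `padSymbol i t`. -/
noncomputable def padTerm (i : I) {n : ℕ} (t : (L i).Term (Fin n)) {V : Type*}
    (x : Fin n → (prodLang L).Term V) (z : (prodLang L).Term V) : (prodLang L).Term V :=
  .func (padSymbol i t) (Fin.snoc (α := fun _ => (prodLang L).Term V) x z)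

theorem realize_padTerm (i : I) {n : ℕ} (t : (L i).Term (Fin n)) {V : Type*}
    (x : Fin n → (prodLang L).Term V) (z : (prodLang L).Term V) {A : Type*}
    [(prodLang L).Structure A] (v : V → A) : (padTerm i t x z).realize v =
      Structure.funMap (padSymbol i t)
        (Fin.snoc (α := fun _ => A) (fun k => (x k).realize v) (z.realize v)) := by
  rw [padTerm, Term.realize_func]
  congr 1
  funext k
  refine Fin.lastCases ?_ (fun k => ?_) k <;> simp

/-- In every algebra of the product language, the operation `d(x, z)` given by the symbol whose
component at `i` is `x` and whose other components are `z`. In a product it replaces all coordinates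
of `x`, except the one at `i`, by those of `z`. -/
noncomputable def replaceOff (L : I → FirstOrder.Language.{u, 0}) (i : I) {A : Type*}
    [(prodLang L).Structure A] (x z : A) : A :=
  Structure.funMap (padSymbol (L := L) i (.var 0 : (L i).Term (Fin 1)))
    (Fin.snoc (α := fun _ => A) (fun _ => x) z)

/-- The formula `d(x, z)` corresponding to `replaceOff`. -/
noncomputable def replaceTerm (L : I → FirstOrder.Language.{u, 0}) (i : I) {V : Type*}
    (x z : (prodLang L).Term V) : (prodLang L).Term V :=
  padTerm i (.var 0 : (L i).Term (Fin 1)) (fun _ => x) z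

theorem realize_replaceTerm (i : I) {V : Type*} (x z : (prodLang L).Term V) {A : Type*}
    [(prodLang L).Structure A] (v : V → A) :
    (replaceTerm L i x z).realize v = replaceOff L i (x.realize v) (z.realize v) :=
  realize_padTerm ..

/-- A formula of `Lᵢ` as a formula of the product language: its component at `i` is the given
formula and its other components are the additional variable `none`. -/
noncomputable def padLift (i : I) {V : Type*} : (L i).Term V → (prodLang L).Term (Option V)
  | .var x => replaceTerm L i (.var (some x)) (.var none)
  | .func f ts =>
    replaceTerm L i (padTerm i (.func f .var) (fun k => padLift i (ts k)) (.var none)) (.var none)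

variable [∀ i, (L i).IsAlgebraic]

theorem replaceOff_self (i : I) (M : AlgMatrix (L i)) (x z : M.carrier) :
    replaceOff L i (A := (viaProj L i M).carrier) x z = x :=
  funMap_padSymbol_self i _ M _ z

theorem replaceOff_of_ne {i j : I} (h : j ≠ i) (M : AlgMatrix (L j)) (x z : M.carrier) :
    replaceOff L i (A := (viaProj L j M).carrier) x z = z :=
  funMap_padSymbol_of_ne h _ M _ z

theorem realize_padLift_self (i : I) (M : AlgMatrix (L i)) {V : Type*} (t : (L i).Term V)
    (v : Option V → (viaProj L i M).carrier) :
    (padLift i t).realize v = t.realize (M := M.carrier) (v ∘ some) := by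
  induction t with
  | var x =>
    rw [padLift, realize_replaceTerm]
    exact replaceOff_self i M _ _
  | func f ts ih =>
    rw [padLift, realize_replaceTerm, realize_padTerm]
    refine (replaceOff_self i M _ _).trans ((funMap_padSymbol_self i _ M _ _).trans ?_)
    simp only [ih]
    rfl

theorem realize_padLift_of_ne {i j : I} (h : j ≠ i) (M : AlgMatrix (L j)) {V : Type*}
    (t : (L i).Term V) (v : Option V → (viaProj L j M).carrier) :
    (padLift i t).realize v = v none := by
  cases t <;> (rw [padLift, realize_replaceTerm]; exact replaceOff_of_ne h M _ _)

/-! ### The components of an algebra of the product language -/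

/-- The component at `i` of an algebra `A` of the product language, relative to a base point `c`:
the range of the map `x ↦ d(x, c)`. In a product it consists of the elements that agree with `c` off
`i`, so it is a copy of the factor at `i`. -/
def Component (L : I → FirstOrder.Language.{u, 0}) (i : I) {A : Type u} [(prodLang L).Structure A]
    (c : A) : Type u :=
  Set.range fun x : A => replaceOff L i x c

/-- The map `x ↦ d(x, c)` onto the component of `A`. -/
noncomputable def toComponent (L : I → FirstOrder.Language.{u, 0}) (i : I) {A : Type u}
    [(prodLang L).Structure A] (c x : A) : Component L i c :=
  ⟨replaceOff L i x c, x, rfl⟩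

omit [∀ i, (L i).IsAlgebraic] in
theorem toComponent_surjective (i : I) {A : Type u} [(prodLang L).Structure A] (c : A) :
    Function.Surjective (toComponent L i c) := by
  rintro ⟨_, x, rfl⟩
  exact ⟨x, rfl⟩

noncomputable instance componentStructure (L : I → FirstOrder.Language.{u, 0})
    [∀ i, (L i).IsAlgebraic] (i : I) {A : Type u} [(prodLang L).Structure A] (c : A) :
    (L i).Structure (Component L i c) where
  funMap {n} f b := toComponent L i c (Structure.funMap (padSymbol i (.func f .var))
    (Fin.snoc (α := fun _ => A) (fun k => (b k).1) c))

theorem realize_component (i : I) {A : Type u} [(prodLang L).Structure A] (c : A) {V : Type*}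
    (t : (L i).Term V) (v : V → A) : (t.realize fun x => toComponent L i c (v x)).1 =
      (padLift i t).realize fun o => o.elim c v := by
  induction t with
  | var x =>
    rw [padLift, realize_replaceTerm]
    rfl
  | func f ts ih =>
    rw [padLift, realize_replaceTerm, realize_padTerm]
    simp only [← ih]
    rfl

end

/-! ### Consequences of non-indexed products -/

section

variable {I : Type u} (S : I → Logic.{u})

/-- The languages of a family of logics. -/
abbrev langs (i : I) : FirstOrder.Language.{u, 0} := (S i).lang

/-- The class of matrices inducing the non-indexed product. -/
abbrev prodModSuszko : Set (AlgMatrix (prodLang (langs S))) :=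
  prodClass fun i => (S i).ModSuszko

variable {S}

theorem exists_prodModSuszko (i : I) {Q : AlgMatrix (S i).lang} (hQ : Q ∈ (S i).ModSuszko) :
    ∃ M : ∀ j, AlgMatrix (S j).lang, (∀ j, M j ∈ (S j).ModSuszko) ∧ M i = Q ∧
      ∀ j, j ≠ i → (M j).filter = Set.univ := by
  classical
  choose E hE hE' using fun j => exists_trivial_mem_modSuszko (S j)
  refine ⟨Function.update E i Q, fun j => ?_, Function.update_self .., fun j hj => ?_⟩
  · by_cases hj : j = i
    · subst hj
      rwa [Function.update_self]
    · rw [Function.update_of_ne hj]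
      exact hE j
  · rw [Function.update_of_ne hj]
    exact hE' j

/-- The consequences of the product class are those that hold componentwise: since the trivial
matrices are models of all logics, every valuation in a member of `ModSuszko (Sᵢ)` extends to a
valuation in a product all of whose other coordinates are designated. -/
theorem conseq_prod_iff {V : Type*} {Γ : Set ((prodLang (langs S)).Term V)}
    {φ : (prodLang (langs S)).Term V} :
    (∀ N ∈ prodModSuszko S, ∀ v : V → N.carrier,
      (∀ γ ∈ Γ, γ.realize v ∈ N.filter) → φ.realize v ∈ N.filter) ↔
    ∀ i, ∀ Q ∈ (S i).ModSuszko, ∀ v : V → (viaProj (langs S) i Q).carrier,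
      (∀ γ ∈ Γ, γ.realize v ∈ (viaProj (langs S) i Q).filter) →
        φ.realize v ∈ (viaProj (langs S) i Q).filter := by
  classical
  constructor
  · intro h i Q hQ v hv
    obtain ⟨M, hM, rfl, hM'⟩ := exists_prodModSuszko i hQ
    let w : V → (prodMatrix M).carrier := fun x =>
      Function.update (β := fun j => (M j).carrier) (fun _ => Classical.arbitrary _) i (v x)
    have hw : (fun x => w x i) = v := funext fun x => Function.update_self ..
    have key := h (prodMatrix M) ⟨M, hM, FirstOrder.Language.Equiv.refl _ _, fun _ => Iff.rfl⟩
      w ?_ i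
    · rwa [realize_prodMatrix, hw] at key
    · intro γ hγ j
      by_cases hj : j = i
      · subst hj
        rw [realize_prodMatrix, hw]
        exact hv γ hγ
      · rw [hM' j hj]
        trivial
  · rintro h N ⟨M, hM, e, he⟩ v hv
    rw [← he, ← HomClass.realize_term]
    intro i
    rw [realize_prodMatrix]
    refine h i (M i) (hM i) _ fun γ hγ => ?_
    rw [← realize_prodMatrix M γ (e ∘ v) i]
    rw [HomClass.realize_term]
    exact (he _).2 (hv γ hγ) i

theorem realize_eq_of_forall_viaProj {V : Type*} {φ ψ : (prodLang (langs S)).Term V}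
    (h : ∀ i, ∀ Q ∈ (S i).ModSuszko, ∀ v : V → (viaProj (langs S) i Q).carrier,
      φ.realize v = ψ.realize v) :
    ∀ N ∈ prodModSuszko S, ∀ v : V → N.carrier, φ.realize v = ψ.realize v := by
  rintro N ⟨M, hM, e, -⟩ v
  refine e.injective ?_
  rw [← HomClass.realize_term, ← HomClass.realize_term]
  funext i
  rw [realize_prodMatrix, realize_prodMatrix]
  exact h i (M i) (hM i) _

variable (S) in
/-- The non-indexed product of a nonempty family. -/
noncomputable abbrev prodLogic [Nonempty I] : Logic.{u} :=
  Logic.induced (Cardinal.prod fun i => #(S i).Fm) (aleph0_le_prod S) (prodModSuszko S)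

variable (S) in
theorem nonempty_embedding_option_var [Nonempty I] (i : I) :
    Nonempty (Option (S i).Var ↪ (Cardinal.prod fun i => #(S i).Fm).ord.ToType) := by
  classical
  rw [← Cardinal.le_def, Cardinal.mk_option, Cardinal.mk_ord_toType, Cardinal.mk_ord_toType,
    Cardinal.add_one_of_aleph0_le (S i).aleph0_le, ← Cardinal.mk_pi,
    ← Cardinal.mk_ord_toType (S i).κ]
  have hne : ∀ j, Nonempty (S j).Var := fun j => Cardinal.mk_ne_zero_iff.1 <| by
    rw [Cardinal.mk_ord_toType]
    exact (Cardinal.aleph0_pos.trans_le (S j).aleph0_le).ne'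
  let E : ∀ j, (S j).Fm := fun j => .var (Classical.choice (hne j))
  refine Cardinal.mk_le_of_injective (f := fun x => Function.update E i (.var x)) fun x y h => ?_
  exact Term.var.inj (Function.update_injective E i h)

/-! ### The non-indexed product as a lower bound -/

theorem isFilter_viaProj [Nonempty I] (i : I) {M : AlgMatrix (S i).lang} {G : Set M.carrier}
    (hG : (S i).IsFilter G) :
    @Logic.IsFilter (prodLogic S) (viaProj (langs S) i M).carrier
      (viaProj (langs S) i M).str G := by
  obtain ⟨Q, hQ, q, -, hq⟩ := exists_reduction (S i) hG
  let q' : (viaProj (langs S) i M).carrier →[prodLang (langs S)] (viaProj (langs S) i Q).carrier :=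
    homOfAlgebraic (A := (viaProj (langs S) i M).carrier)
      (B := (viaProj (langs S) i Q).carrier) q fun n f x => (HomClass.realize_term q).symm
  have hq' : ∀ a, q' a ∈ (viaProj (langs S) i Q).filter ↔ a ∈ G := hq
  refine isFilter_induced_iff.2 fun Γ φ h v hv => (hq' _).1 ?_
  rw [← HomClass.realize_term]
  refine conseq_prod_iff.1 h i Q hQ (q' ∘ v) fun γ hγ => ?_
  rw [HomClass.realize_term]
  exact (hq' _).2 (hv γ hγ)

theorem leibniz_of_viaProj (i : I) {M : AlgMatrix (S i).lang} {G : Set M.carrier}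
    {a b : M.carrier}
    (h : @leibniz _ M.carrier (viaProj (langs S) i M).str G a b) :
    leibniz (S i).lang G a b := by
  classical
  obtain ⟨hc, hG⟩ := (@leibniz_isGreatest _ M.carrier
    (viaProj (langs S) i M).str G).1
  refine (leibniz_isGreatest (S i).lang G).2 ⟨?_, hG⟩ h
  intro n f x y hxy
  cases n with
  | zero => exact isEmptyElim f
  | succ n =>
    let g : ∀ j, (S j).lang.Term (Fin (n + 1)) :=
      Function.update (fun _ => .var 0) i (.func f .var)
    have hg : g i = .func f .var := Function.update_self ..
    have := hc (n + 1) g x y hxy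
    change (@leibniz _ M.carrier (viaProj (langs S) i M).str G)
      (Term.realize (L := (S i).lang) x (g i))
      (Term.realize (L := (S i).lang) y (g i)) at this
    rwa [hg] at this

theorem prodLogic_le [Nonempty I] (i : I) : prodLogic S ≤ S i := by
  refine ⟨projTranslation (langs S) i, fun M hM => ⟨isFilter_viaProj i hM.1, ?_⟩⟩
  refine eq_bot_iff.2 fun a b hab => ?_
  change (⊥ : Setoid M.carrier) a b
  rw [← hM.2]
  refine suszko_iff.2 fun G hG hFG => leibniz_of_viaProj i ?_
  exact (@suszko_induced_iff (prodLang (langs S)) _ _ _ (aleph0_le_prod S) _ M.carrier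
    (viaProj (langs S) i M).str _ a b).1 hab G (isFilter_viaProj i hG) hFG

end

/-! ### The non-indexed product as the greatest lower bound -/

section

variable {I : Type u} {S : I → Logic.{u}} [Nonempty I]

theorem mem_filter_iff_replaceOff_mem {A : Type u} [(prodLang (langs S)).Structure A] {G : Set A}
    (hG : @Logic.IsFilter (prodLogic S) A ‹_› G) {c : A} (hc : c ∈ G) (a : A) :
    a ∈ G ↔ ∀ i, replaceOff (langs S) i a c ∈ G := by
  obtain ⟨g⟩ := nonempty_embedding_of_countable (aleph0_le_prod S) Bool
  let v : Bool → A := fun b => cond b a c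
  let t : I → (prodLang (langs S)).Term Bool := fun i =>
    replaceTerm (langs S) i (.var true) (.var false)
  have ht : ∀ i, (t i).realize v = replaceOff (langs S) i a c := fun i =>
    realize_replaceTerm i _ _ v
  constructor
  · intro ha i
    rw [← ht]
    refine mem_filter_of_conseq hG g (Γ := Set.range .var)
      (conseq_prod_iff.2 fun j Q hQ u hu => ?_) ?_
    · rw [realize_replaceTerm]
      by_cases hj : j = i
      · subst hj
        exact (congrArg (· ∈ Q.filter) (replaceOff_self (L := langs S) j Q _ _)).mpr <|
          hu _ ⟨true, rfl⟩
      · exact (congrArg (· ∈ Q.filter) (replaceOff_of_ne (L := langs S) hj Q _ _)).mpr <|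
          hu _ ⟨false, rfl⟩
    · rintro _ ⟨b, rfl⟩
      cases b
      exacts [hc, ha]
  · intro h
    refine mem_filter_of_conseq hG g (Γ := Set.range t) (φ := .var true) (v := v)
      (conseq_prod_iff.2 fun j Q hQ u hu => ?_) ?_
    · have := hu _ ⟨j, rfl⟩
      rw [realize_replaceTerm] at this
      exact (congrArg (· ∈ Q.filter) (replaceOff_self (L := langs S) j Q _ _)).mp this
    · rintro _ ⟨i, rfl⟩
      rw [ht]
      exact h i

noncomputable instance (i : I) {A : Type u} [(prodLang (langs S)).Structure A] (c : A) :
    (S i).lang.Structure (Component (langs S) i c) :=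
  componentStructure (langs S) i c

/-- The component at `i` of a deductive filter `G` of the product with base point in `G` is a
deductive filter of `Sᵢ`. -/
theorem isFilter_component {A : Type u} [(prodLang (langs S)).Structure A] {G : Set A}
    (hG : @Logic.IsFilter (prodLogic S) A ‹_› G) {c : A} (hc : c ∈ G) (i : I) :
    (S i).IsFilter {b : Component (langs S) i c | b.1 ∈ G} := by
  intro Γ φ hφ v hv
  obtain ⟨w, rfl⟩ := (toComponent_surjective (L := langs S) i c).comp_left v
  obtain ⟨g⟩ := nonempty_embedding_option_var S i
  have hr : ∀ t : (S i).Fm, (t.realize (toComponent (langs S) i c ∘ w)).1 =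
      (padLift (L := langs S) i t).realize fun o => o.elim c w := fun t =>
    realize_component (L := langs S) i c t w
  rw [Set.mem_ofPred_eq, hr]
  refine mem_filter_of_conseq hG g
    (Γ := insert (.var none) (padLift (L := langs S) i '' Γ))
    (conseq_prod_iff.2 fun j Q hQ u hu => ?_) ?_
  · by_cases hj : j = i
    · subst hj
      rw [realize_padLift_self]
      refine hQ.1 Γ φ hφ _ fun γ hγ => ?_
      have := hu _ (.inr ⟨γ, hγ, rfl⟩)
      rwa [realize_padLift_self] at this
    · rw [realize_padLift_of_ne hj]
      exact hu _ (.inl rfl)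
  · rintro _ (rfl | ⟨γ, hγ, rfl⟩)
    · exact hc
    · rw [← hr]
      exact hv γ hγ

/-- If the identities of the product class hold in `A`, then the map of `A` onto its component at
`i` turns the operations of `A` into their components at `i`. -/
theorem toComponent_funMap {M : AlgMatrix (prodLang (langs S))} (hM : M ∈ (prodLogic S).ModSuszko)
    (i : I) (c : M.carrier) {n : ℕ} (f : (prodLang (langs S)).Functions n)
    (x : Fin n → M.carrier) : toComponent (langs S) i c (Structure.funMap f x) =
      Term.realize (fun k => toComponent (langs S) i c (x k)) (f i) := by
  refine Subtype.ext ?_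
  rw [realize_component]
  let φ : (prodLang (langs S)).Term (Option (Fin n)) :=
    replaceTerm (langs S) i (.func f fun k => .var (some k)) (.var none)
  have hφ : φ.realize (fun o => o.elim c x) =
      replaceOff (langs S) i (Structure.funMap f x) c := realize_replaceTerm i _ _ _
  refine hφ.symm.trans (realize_eq_of_mem_modSuszko hM
    (realize_eq_of_forall_viaProj fun j Q hQ v => ?_) _)
  rw [realize_replaceTerm]
  by_cases hj : j = i
  · subst hj
    rw [realize_padLift_self]
    exact replaceOff_self (L := langs S) j Q _ _
  · rw [realize_padLift_of_ne hj]
    exact replaceOff_of_ne (L := langs S) hj Q _ _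

/-- For every deductive filter `G` and every base point `c ∈ G`, a member of `ModSuszko` of the
product maps onto a member of `ModSuszko (Sᵢ)`, namely onto the Suszko quotient of its component
at `i`. -/
theorem exists_hom_viaProj {M : AlgMatrix (prodLang (langs S))}
    (hM : M ∈ (prodLogic S).ModSuszko) {G : Set M.carrier}
    (hG : @Logic.IsFilter (prodLogic S) M.carrier M.str G) {c : M.carrier} (hc : c ∈ G) (i : I) :
    ∃ Q ∈ (S i).ModSuszko,
      ∃ h : M.carrier →[prodLang (langs S)] (viaProj (langs S) i Q).carrier,
        Function.Surjective h ∧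
          ∀ a, h a ∈ (viaProj (langs S) i Q).filter ↔ replaceOff (langs S) i a c ∈ G := by
  have : Nonempty (Component (langs S) i c) := ⟨toComponent (langs S) i c c⟩
  obtain ⟨Q, hQ, q, hs, hq⟩ := exists_reduction (S i) (isFilter_component hG hc i)
  refine ⟨Q, hQ, homOfAlgebraic (B := (viaProj (langs S) i Q).carrier)
    (fun a => q (toComponent (langs S) i c a)) fun n f x => ?_,
    hs.comp (toComponent_surjective i c), fun a => hq (toComponent (langs S) i c a)⟩
  rw [toComponent_funMap hM]
  exact (HomClass.realize_term q).symm

/-- The translation into the product language whose components are the given translations. -/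
def prodTranslation {L' : FirstOrder.Language.{u, 0}} {L : I → FirstOrder.Language.{u, 0}}
    (τ : ∀ i, Translation L' (L i)) : Translation L' (prodLang L) :=
  fun n f => .func (fun i => τ i n f : (prodLang L).Functions n) .var

variable {T : Logic.{u}} {τ : ∀ i, Translation T.lang (S i).lang}

/-- A homomorphism into an algebra of the language of `Sᵢ`, as a homomorphism between the reducts
along `prodTranslation τ` and `τ i`. -/
def homReduct {M : AlgMatrix (prodLang (langs S))} {i : I} {Q : AlgMatrix (S i).lang}
    (τ : ∀ i, Translation T.lang (S i).lang)
    (h : M.carrier →[prodLang (langs S)] (viaProj (langs S) i Q).carrier) :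
    (M.reduct (prodTranslation (L := langs S) τ)).carrier →[T.lang] (Q.reduct (τ i)).carrier :=
  homOfAlgebraic (A := (M.reduct (prodTranslation (L := langs S) τ)).carrier)
    (B := (Q.reduct (τ i)).carrier) h fun n f x =>
      h.map_fun (fun i => τ i n f : (prodLang (langs S)).Functions n) x

/-- The filters of members of `ModSuszko` of the product are nonempty as soon as `T` has a
theorem: in one variable, its translation is a theorem of the product. -/
theorem filter_nonempty_of_theorem (hτ : ∀ i, IsInterpretation T (S i) (τ i))
    {M : AlgMatrix (prodLang (langs S))} (hM : M ∈ (prodLogic S).ModSuszko) {φ : T.Fm}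
    (hφ : T.entails ∅ φ) : M.filter.Nonempty := by
  obtain ⟨g⟩ := nonempty_embedding_of_countable (aleph0_le_prod S) Unit
  let ψ : T.lang.Term Unit := φ.subst fun _ => .var ()
  refine ⟨_, mem_filter_of_conseq hM.1 g (Γ := ∅)
    (φ := (prodTranslation (L := langs S) τ).onTerm ψ) (v := fun _ => Classical.arbitrary _)
    (conseq_prod_iff.2 fun i Q hQ u _ => ?_) fun γ hγ => hγ.elim⟩
  rw [Translation.realize_onTerm]
  have key : ∀ u : Unit → (Q.reduct (τ i)).carrier, ψ.realize u ∈ (Q.reduct (τ i)).filter := by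
    intro u
    rw [Term.realize_subst]
    exact (hτ i Q hQ).1 ∅ φ hφ _ fun γ hγ => hγ.elim
  exact key u

theorem isFilter_reduct_prodTranslation (hτ : ∀ i, IsInterpretation T (S i) (τ i))
    {M : AlgMatrix (prodLang (langs S))} (hM : M ∈ (prodLogic S).ModSuszko) :
    T.IsFilter (M.reduct (prodTranslation (L := langs S) τ)).filter := by
  intro Γ φ hφ v hv
  obtain ⟨c, hc⟩ : M.filter.Nonempty := by
    rcases Γ.eq_empty_or_nonempty with rfl | ⟨γ, hγ⟩
    · exact filter_nonempty_of_theorem hτ hM hφ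
    · exact ⟨_, hv γ hγ⟩
  have key := mem_filter_iff_replaceOff_mem hM.1 hc
  refine (key _).2 fun i => ?_
  obtain ⟨Q, hQ, h, -, hh⟩ := exists_hom_viaProj hM hM.1 hc i
  have hh' : ∀ a, homReduct τ h a ∈ (Q.reduct (τ i)).filter ↔
      replaceOff (langs S) i (A := M.carrier) a c ∈ M.filter := hh
  rw [← hh', ← HomClass.realize_term]
  refine (hτ i Q hQ).1 Γ φ hφ _ fun γ hγ => ?_
  rw [HomClass.realize_term, hh']
  exact (key _).1 (hv γ hγ) i

/-- A deductive filter `G` of the product that separates `p(a)` from `p(b)` does so in some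
component, and hence some member of `ModSuszko (Sᵢ)` separates the images of `a` and `b`. -/
theorem not_suszko_of_mem_of_notMem (hτ : ∀ i, IsInterpretation T (S i) (τ i))
    {M : AlgMatrix (prodLang (langs S))} (hM : M ∈ (prodLogic S).ModSuszko) {G : Set M.carrier}
    (hG : @Logic.IsFilter (prodLogic S) M.carrier M.str G) (hMG : M.filter ⊆ G) {V : Type}
    {p : (prodLang (langs S)).Term (Option V)} {v : V → M.carrier} {a b : M.carrier}
    (ha : p.realize (fun o => o.elim a v) ∈ G) (hb : p.realize (fun o => o.elim b v) ∉ G) :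
    ¬ @Logic.suszko T M.carrier (M.reduct (prodTranslation (L := langs S) τ)).str M.filter a b := by
  intro hab
  have key := mem_filter_iff_replaceOff_mem hG ha
  obtain ⟨i, hi⟩ := not_forall.1 (mt (key _).2 hb)
  obtain ⟨Q, hQ, h, hs, hh⟩ := exists_hom_viaProj hM hG ha i
  have hne : h a ≠ h b := by
    intro e
    have hp : ∀ x, h (p.realize fun o => o.elim x v) = p.realize fun o => o.elim (h x) (h ∘ v) := by
      intro x
      rw [← HomClass.realize_term]
      congr 1
      funext o
      cases o <;> rfl
    refine hi ((hh _).1 ?_)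
    rw [hp, ← e, ← hp]
    exact (hh _).2 ((key _).1 ha i)
  refine hne ?_
  have hbot : T.suszko (Q.reduct (τ i)).filter (h a) (h b) := by
    refine suszko_iff.2 fun H hH hQH => ?_
    refine (leibniz_preimage_iff (homReduct τ h) hs).1 ?_
    refine (@suszko_iff T M.carrier (M.reduct (prodTranslation (L := langs S) τ)).str _ a b).1 hab
      _ (hH.preimage (homReduct τ h)) fun x hx => hQH ?_
    exact (hh x).2 ((key x).1 (hMG hx) i)
  rw [(hτ i Q hQ).2] at hbot
  exact hbot

theorem le_prodLogic {T : Logic.{u}} (h : ∀ i, T ≤ S i) : T ≤ prodLogic S := by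
  choose τ hτ using h
  refine ⟨prodTranslation (L := langs S) τ, fun (M : AlgMatrix (prodLang (langs S))) hM =>
    ⟨isFilter_reduct_prodTranslation hτ hM, eq_bot_iff.2 fun a b hab => ?_⟩⟩
  change (⊥ : Setoid M.carrier) a b
  rw [← hM.2]
  refine suszko_induced_iff.2 fun G hG hMG => leibniz_iff.2 fun V _ p v => ?_
  constructor
  · intro ha
    by_contra hb
    exact not_suszko_of_mem_of_notMem hτ hM hG hMG ha hb hab
  · intro hb
    by_contra ha
    exact not_suszko_of_mem_of_notMem hτ hM hG hMG hb ha (Setoid.symm' _ hab)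

end

/-! ### The empty product -/

/-- Every logic is interpretable into the logic of the trivial matrix. Its reduced models are
trivial, so any translation will do, for instance the one sending every symbol to `x₁`. -/
theorem le_induced_trivialMatrix (T : Logic.{u}) :
    T ≤ Logic.induced ℵ₀ le_rfl {trivialMatrix.{u}} := by
  let τ : Translation T.lang emptyLang.{u} := fun n f =>
    match n, f with
    | 0, f => isEmptyElim f
    | _ + 1, _ => .var 0
  refine ⟨τ, fun (M : AlgMatrix emptyLang.{u}) hM => ?_⟩
  obtain ⟨g⟩ := nonempty_embedding_of_countable (le_refl ℵ₀) Unit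
  have huniv : ∀ G : Set M.carrier,
      @Logic.IsFilter (Logic.induced ℵ₀ le_rfl {trivialMatrix.{u}}) M.carrier M.str G →
        G = Set.univ := by
    refine fun G hG => Set.eq_univ_of_forall fun a => ?_
    refine mem_filter_of_conseq hG g (Γ := ∅) (φ := .var ()) (v := fun _ => a) ?_
      fun γ hγ => hγ.elim
    rintro _ rfl v -
    exact Set.mem_univ _
  have : Subsingleton (M.reduct τ).carrier := by
    refine ⟨fun (a b : M.carrier) => ?_⟩
    change (⊥ : Setoid M.carrier) a b
    rw [← hM.2]
    refine suszko_induced_iff.2 fun G hG _ => leibniz_iff.2 fun V _ p v => ?_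
    simp [huniv G hG]
  exact @mem_modSuszko_of_subsingleton T (M.reduct τ) this (huniv _ hM.1)

theorem isGLB_prod {I : Type u} (S : I → Logic.{u}) :
    IsGLB (Set.range fun i => (S i).toLog) (Logic.prod S).toLog := by
  rcases isEmpty_or_nonempty I with hI | hI
  · have hS : Logic.prod S = Logic.induced ℵ₀ le_rfl {trivialMatrix.{u}} :=
      dif_neg (not_nonempty_iff.2 hI)
    rw [hS, Set.range_eq_empty, isGLB_empty_iff]
    intro t
    induction t using Quotient.inductionOn with
    | _ T => exact le_induced_trivialMatrix T
  · have hS : Logic.prod S = prodLogic S := dif_pos hI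
    rw [hS]
    constructor
    · rintro _ ⟨i, rfl⟩
      exact prodLogic_le i
    · intro t
      induction t using Quotient.inductionOn with
      | _ T => exact fun h => le_prodLogic fun i => h ⟨i, rfl⟩

end AAL

theorem theorem4 :
    (∀ (I : Type u) (S : I → AAL.Logic.{u}),
      IsGLB (Set.range fun i => (S i).toLog) (AAL.Logic.prod S).toLog) ∧
    (∀ A : Set AAL.Log.{u}, Small.{u} A → ∃ a : AAL.Log.{u}, IsGLB A a) := by
  refine ⟨fun I S => AAL.isGLB_prod S, fun A hA => ?_⟩
  let S : Shrink.{u} A → AAL.Logic.{u} := fun x => Quotient.out ((equivShrink A).symm x).1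
  have hS : (Set.range fun x => (S x).toLog) = A := by
    have : (fun x => (S x).toLog) = Subtype.val ∘ (equivShrink A).symm :=
      funext fun x => Quotient.out_eq _
    rw [this, Set.range_comp, Equiv.range_eq_univ, Set.image_univ, Subtype.range_coe]
  exact ⟨_, hS ▸ AAL.isGLB_prod S⟩
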